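/- Let $(W_e)_{e\in\mathbb N}$ be the standard enumeration of the recursively enumerable (r.e.) subsets of $\mathbb N$ ($W_e$ is the domain of the partial recursive function with Gödel number $e$), and let $\mathrm{Inf}=\{e : W_e \text{ is infinite}\}$. An r.e. set $A\subseteq\mathbb N$ is called semilow$_{1.5}$ if $\{e : W_e\cap\overline{A}\text{ is infinite}\}\le_1 \mathrm{Inf}$, where $\overline A=\mathbb N\setminus A$ and $P\le_1 Q$ means that there is an injective total recursive function $f$ with $e\in P \iff f(e)\in Q$ for all $e$. A split of an r.e. set $B$ is a pair of disjoint r.e. sets $X,Y$ with $X\cup Y=B$. There is an r.e. set $B$ that is not semilow$_{1.5}$ such that for every split $X,Y$ of $B$, at least one of $X$ and $Y$ is semilow$_{1.5}$. -/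

import Mathlib

/-- The `e`-th recursively enumerable set `W e ⊆ ℕ`: the domain of the partial recursive function
with Gödel number `e`. -/
def W (e : ℕ) : Set ℕ :=
  {x | ((Denumerable.ofNat Nat.Partrec.Code e).eval x).Dom}

/-- A set of natural numbers is recursively enumerable (r.e.). -/
def IsRE (A : Set ℕ) : Prop :=
  REPred fun x => x ∈ A

/-- The index set `Inf` of all `e` such that `W e` is infinite. -/
def InfIdx : Set ℕ :=
  {e | (W e).Infinite}

/-- `A` is semilow₁.₅: the set `{e | W e ∩ Aᶜ is infinite}` is one-one reducible to `Inf`,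
through a total recursive injection `ℕ → ℕ`. The notion is used for r.e. sets `A`. -/
def IsSemilowOnePointFive (A : Set ℕ) : Prop :=
  OneOneReducible (fun e => (W e ∩ Aᶜ).Infinite) (fun e => e ∈ InfIdx)

/-- `X, Y` is a split(ting) of `B`: a pair of disjoint r.e. sets whose union is `B`. -/
structure IsSplit (B X Y : Set ℕ) : Prop where
  re_left : IsRE X
  re_right : IsRE Y
  disj : Disjoint X Y
  union_eq : X ∪ Y = B

/-! Take `maxSet` for B, a maximal set: its complement is infinite, and each r.e. set contains or
misses almost all of it (`finite_inter_or_finite_diff`). It is built with markers that move to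
numbers of higher state.

Let X, Y split B. If some `W e` meets Bᶜ infinitely but Y only finitely, then X ∪ `W e` equals Yᶜ up
to a finite set, so Y is semilow₁.₅. Otherwise Y meets infinitely each r.e. set that meets Bᶜ
infinitely, and serves as the test set for X.

A reduction f for B is defeated by the recursion theorem (`exists_balanced_partition`): split ℕ into
`W a` and `W b`, sending s to the part whose image under f looks smaller at stage s. Almost all of
Bᶜ lies in one part, so only that part has an infinite image; then almost every s is sent to the
other part, a contradiction. -/

open Nat.Partrec (Code)

namespace MaximalSet

/-! ### States and their limits -/

/-- The finite stage `s` approximation to membership of `x` in `W e`. -/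
def stage (s e x : ℕ) : Bool :=
  ((Denumerable.ofNat Code e).evaln s x).isSome

theorem stage_mono {s t e x : ℕ} (hst : s ≤ t) (h : stage s e x = true) : stage t e x = true := by
  obtain ⟨y, hy⟩ := Option.isSome_iff_exists.1 h
  exact Option.isSome_iff_exists.2 ⟨y, Code.evaln_mono hst hy⟩

theorem mem_W_iff_stage {e x : ℕ} : x ∈ W e ↔ ∃ s, stage s e x = true := by
  simp only [W, Set.mem_ofPred_eq, Part.dom_iff_mem, Code.evaln_complete, stage,
    Option.isSome_iff_exists]
  exact exists_comm

theorem primrec_stage : Primrec fun p : (ℕ × ℕ) × ℕ => stage p.1.1 p.1.2 p.2 :=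
  Primrec.option_isSome.comp <| Code.primrec_evaln.comp <|
    ((Primrec.fst.comp Primrec.fst).pair
      ((Primrec.ofNat Code).comp (Primrec.snd.comp Primrec.fst))).pair Primrec.snd

/-- The stage `s` value of the `e`-state of `x`: the binary number whose digits, most significant
first, record the membership of `x` in `W 0, …, W (e - 1)`. -/
def estate (s e x : ℕ) : ℕ :=
  Nat.rec 0 (fun i r => 2 * r + (stage s i x).toNat) e

theorem estate_succ (s e x : ℕ) :
    estate s (e + 1) x = 2 * estate s e x + (stage s e x).toNat := rfl

open Classical in
/-- The limit of the `e`-states of `x`. -/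
noncomputable def limState (e x : ℕ) : ℕ :=
  Nat.rec 0 (fun i r => 2 * r + (decide (x ∈ W i)).toNat) e

open Classical in
theorem limState_succ (e x : ℕ) :
    limState (e + 1) x = 2 * limState e x + (decide (x ∈ W e)).toNat := rfl

theorem estate_mono {s t : ℕ} (hst : s ≤ t) (e x : ℕ) : estate s e x ≤ estate t e x := by
  induction e with
  | zero => exact le_rfl
  | succ e ih =>
    have h := Bool.toNat_le_toNat (fun h => stage_mono (e := e) (x := x) hst h)
    rw [estate_succ, estate_succ]
    omega

theorem estate_lt (s e x : ℕ) : estate s e x < 2 ^ e := by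
  induction e with
  | zero => exact Nat.one_pos
  | succ e ih =>
    have := Bool.toNat_le (stage s e x)
    rw [estate_succ, pow_succ]
    omega

open Classical in
theorem eventually_estate_eq (e x : ℕ) : ∀ᶠ s in Filter.atTop, estate s e x = limState e x := by
  induction e with
  | zero => exact Filter.Eventually.of_forall fun _ => rfl
  | succ e ih =>
    have h : ∀ᶠ s in Filter.atTop, stage s e x = decide (x ∈ W e) := by
      by_cases hx : x ∈ W e
      · obtain ⟨t, ht⟩ := mem_W_iff_stage.1 hx
        filter_upwards [Filter.eventually_ge_atTop t] with s hs
        simpa [hx] using stage_mono hs ht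
      · refine Filter.Eventually.of_forall fun s => ?_
        simpa [hx] using fun hs => hx (mem_W_iff_stage.2 ⟨s, hs⟩)
    filter_upwards [ih, h] with s h₁ h₂
    rw [estate_succ, limState_succ, h₁, h₂]

open Classical in
-- Later digits are less significant, so they cannot undo a strict inequality.
theorem limState_lt_add {e x y : ℕ} (h : limState e x < limState e y) (k : ℕ) :
    limState (e + k) x < limState (e + k) y := by
  induction k with
  | zero => exact h
  | succ k ih =>
    have := Bool.toNat_le (decide (x ∈ W (e + k)))
    rw [← add_assoc, limState_succ, limState_succ]
    omega

theorem primrec_estate : Primrec fun p : (ℕ × ℕ) × ℕ => estate p.1.1 p.1.2 p.2 := by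
  refine Primrec.nat_rec' (f := fun p : (ℕ × ℕ) × ℕ => p.1.2)
    (h := fun p q => 2 * q.2 + (stage p.1.1 q.1 p.2).toNat)
    (Primrec.snd.comp Primrec.fst) (Primrec.const 0) ?_
  have h : Primrec fun q : ((ℕ × ℕ) × ℕ) × ℕ × ℕ => stage q.1.1.1 q.2.1 q.1.2 :=
    primrec_stage.comp (((Primrec.fst.comp (Primrec.fst.comp Primrec.fst)).pair
      (Primrec.fst.comp Primrec.snd)).pair (Primrec.snd.comp Primrec.fst))
  exact Primrec.nat_add.comp
    (Primrec.nat_mul.comp (Primrec.const 2) (Primrec.snd.comp Primrec.snd))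
    ((Primrec.dom_finite Bool.toNat).comp h)

/-! ### The marker construction of a maximal set -/

/-- The re-indexing of markers that drops the markers `p.1, …, p.1 + p.2 - 1`. -/
def shift (n : ℕ) (p : ℕ × ℕ) : ℕ :=
  if n < p.1 then n else n + p.2

/-- The position of the `n`-th marker after the shifts in `H`, the most recent one first. -/
def position (H : List (ℕ × ℕ)) (n : ℕ) : ℕ :=
  H.foldl shift n

/-- The shift made at stage `s = ⟨e, d, t⟩`: the `e`-th marker moves to the position of the
`(e + d)`-th one if this raises its state. -/
def move (s : ℕ) (H : List (ℕ × ℕ)) : ℕ × ℕ :=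
  (s.unpair.1, if estate s s.unpair.1 (position H s.unpair.1) <
    estate s s.unpair.1 (position H (s.unpair.1 + s.unpair.2.unpair.1))
    then s.unpair.2.unpair.1 else 0)

/-- The list of all shifts made before stage `s`. -/
def history (s : ℕ) : List (ℕ × ℕ) :=
  Nat.rec [] (fun t H => move t H :: H) s

/-- The position of the `n`-th marker at stage `s`. -/
def marker (s n : ℕ) : ℕ :=
  position (history s) n

theorem marker_succ (s n : ℕ) : marker (s + 1) n = marker s (shift n (move s (history s))) := rfl

theorem primrec_shift : Primrec₂ shift :=
  Primrec.ite (Primrec.nat_lt.comp Primrec.fst (Primrec.fst.comp Primrec.snd)) Primrec.fst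
    (Primrec.nat_add.comp Primrec.fst (Primrec.snd.comp Primrec.snd))

theorem primrec_position : Primrec₂ position :=
  Primrec.list_foldl Primrec.fst Primrec.snd (primrec_shift.comp
    (Primrec.fst.comp Primrec.snd) (Primrec.snd.comp Primrec.snd)).to₂

theorem primrec_move : Primrec₂ move := by
  have he : Primrec fun p : ℕ × List (ℕ × ℕ) => p.1.unpair.1 :=
    Primrec.fst.comp (Primrec.unpair.comp Primrec.fst)
  have hd : Primrec fun p : ℕ × List (ℕ × ℕ) => p.1.unpair.2.unpair.1 :=
    Primrec.fst.comp (Primrec.unpair.comp (Primrec.snd.comp (Primrec.unpair.comp Primrec.fst)))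
  exact he.pair (Primrec.ite (Primrec.nat_lt.comp
    (primrec_estate.comp ((Primrec.fst.pair he).pair (primrec_position.comp Primrec.snd he)))
    (primrec_estate.comp ((Primrec.fst.pair he).pair
      (primrec_position.comp Primrec.snd (Primrec.nat_add.comp he hd))))) hd (Primrec.const 0))

theorem primrec_history : Primrec history :=
  Primrec.nat_rec₁ [] (Primrec.list_cons.comp₂ primrec_move Primrec₂.right)

theorem primrec_marker : Primrec₂ marker :=
  primrec_position.comp (primrec_history.comp Primrec.fst) Primrec.snd

theorem strictMono_shift (p : ℕ × ℕ) : StrictMono fun n => shift n p := by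
  intro m n h
  simp only [shift]
  split_ifs <;> omega

theorem strictMono_marker (s : ℕ) : StrictMono (marker s) := by
  induction s with
  | zero => exact strictMono_id
  | succ s ih => exact ih.comp (strictMono_shift _)

/-- The set of numbers that lose their marker at some stage. -/
def maxSet : Set ℕ :=
  -- Markers satisfy `n ≤ marker s n`, so the bound loses nothing and makes the condition decidable.
  {x | ∃ s, ∀ n < x + 1, marker s n ≠ x}

theorem isRE_maxSet : IsRE maxSet := by
  classical
  have h₁ : PrimrecRel fun (n : ℕ) (q : ℕ × ℕ) => marker q.2 n ≠ q.1 :=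
    PrimrecPred.not (Primrec.eq.comp
      (primrec_marker.comp (Primrec.snd.comp Primrec.snd) Primrec.fst)
      (Primrec.fst.comp Primrec.snd))
  have h₂ : PrimrecPred fun q : ℕ × ℕ => ∀ n < q.1 + 1, marker q.2 n ≠ q.1 :=
    (h₁.forall_mem_list.comp (Primrec.list_range.comp (Primrec.succ.comp Primrec.fst))
      Primrec.id).of_eq fun q => by simp
  have h₃ : Partrec fun x : ℕ =>
      Nat.rfind fun s => Part.some (decide (∀ n < x + 1, marker s n ≠ x)) :=
    Partrec.rfind h₂.decide.to_comp.partrec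
  refine h₃.dom_re.of_eq fun x => ?_
  refine Nat.rfind_dom.trans ?_
  simp [maxSet]

theorem notMem_maxSet {x : ℕ} : x ∉ maxSet ↔ ∀ s, ∃ n, marker s n = x := by
  simp only [maxSet, Set.mem_ofPred_eq, not_exists, not_forall, not_not]
  refine forall_congr' fun s => exists_congr fun n => ⟨fun h => h.2, fun h => ⟨?_, h⟩⟩
  exact Nat.lt_succ_of_le (h ▸ (strictMono_marker s).le_apply)

/-- Each stage passes to a subsequence of the old positions, so an abandoned number is never marked
again. -/
theorem exists_marker_eq {s t : ℕ} (hst : s ≤ t) (n : ℕ) : ∃ m, marker s m = marker t n := by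
  induction t, hst using Nat.le_induction generalizing n with
  | base => exact ⟨n, rfl⟩
  | succ t _ ih => exact ih _

theorem exists_forall_ge_eq_of_antitone {f : ℕ → ℕ} (hf : Antitone f) :
    ∃ k, ∀ j ≥ k, f j = f k := by
  obtain ⟨_, ⟨k, rfl⟩, hk⟩ := wellFounded_lt.has_min (Set.range f) ⟨f 0, 0, rfl⟩
  exact ⟨k, fun j hj => (hf hj).antisymm (not_lt.1 (hk _ ⟨j, rfl⟩))⟩

theorem eventually_const_of_monotone_bounded {f : ℕ → ℕ} {s₀ b : ℕ}
    (hf : ∀ s ≥ s₀, f s ≤ f (s + 1)) (hb : ∀ s, f s ≤ b) : ∃ t ≥ s₀, ∀ s ≥ t, f s = f t := by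
  obtain ⟨k, hk⟩ := exists_forall_ge_eq_of_antitone (f := fun k => b - f (s₀ + k))
    (antitone_nat_of_succ_le fun k => Nat.sub_le_sub_left (hf _ (Nat.le_add_right _ _)) b)
  refine ⟨s₀ + k, by omega, fun s hs => ?_⟩
  obtain ⟨j, rfl⟩ := Nat.exists_eq_add_of_le (show s₀ ≤ s by omega)
  have h₁ := hk j (by omega)
  have h₂ := hb (s₀ + j)
  have h₃ := hb (s₀ + k)
  omega

/-- A shift at an index below `e` that changes the markers changes a marker below `e`, and one at
`e` raises the state of the marker. -/
theorem marker_succ_eq_or {s e : ℕ} (h : ∀ i < e, marker (s + 1) i = marker s i) :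
    marker (s + 1) e = marker s e ∨
      estate s e (marker s e) < estate s e (marker (s + 1) e) := by
  set i := s.unpair.1 with hi
  set d := s.unpair.2.unpair.1 with hd
  by_cases hc : estate s i (marker s i) < estate s i (marker s (i + d))
  · have hmove : move s (history s) = (i, d) := by
      simp only [move, ← hi, ← hd]
      exact congrArg _ (if_pos hc)
    have hmk : marker (s + 1) i = marker s (i + d) := by
      simp [marker_succ, hmove, shift]
    rcases lt_trichotomy i e with hlt | rfl | hlt
    · rw [← hmk, h i hlt] at hc
      exact absurd hc (lt_irrefl _)
    · exact Or.inr (hmk ▸ hc)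
    · left
      simp [marker_succ, hmove, shift, hlt]
  · have hmove : move s (history s) = (i, 0) := by
      simp only [move, ← hi, ← hd]
      exact congrArg _ (if_neg hc)
    left
    simp [marker_succ, hmove, shift]

/-- Once the markers below `e` rest, each move of marker `e` raises its state, which never drops and
stays below `2 ^ e`. -/
theorem exists_marker_stable (n : ℕ) : ∃ t, ∀ s ≥ t, marker s n = marker t n := by
  induction n using Nat.strong_induction_on with
  | _ e ih =>
    choose! t ht using ih
    set s₀ := (Finset.range e).sup t with hs₀
    have hfix : ∀ s ≥ s₀, ∀ i < e, marker (s + 1) i = marker s i := fun s hs i hi => by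
      have : t i ≤ s := (Finset.le_sup (Finset.mem_range.2 hi)).trans hs
      rw [ht i hi s this, ht i hi (s + 1) (by omega)]
    obtain ⟨u, hu, hconst⟩ := eventually_const_of_monotone_bounded
      (f := fun s => estate s e (marker s e)) (s₀ := s₀) (b := 2 ^ e)
      (fun s hs => by
        rcases marker_succ_eq_or (hfix s hs) with h | h
        · simpa only [h] using estate_mono (Nat.le_succ s) e (marker s e)
        · exact h.le.trans (estate_mono (Nat.le_succ s) e _))
      (fun s => (estate_lt _ _ _).le)
    refine ⟨u, fun s hs => ?_⟩
    induction s, hs using Nat.le_induction with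
    | base => rfl
    | succ s hs ih' =>
      rcases marker_succ_eq_or (hfix s (hu.trans hs)) with h | h
      · rw [h, ih']
      · have h₁ := hconst s hs
        have h₂ := hconst (s + 1) (by omega)
        have h₃ := estate_mono (Nat.le_succ s) e (marker (s + 1) e)
        simp only [Nat.succ_eq_add_one] at h₁ h₂ h₃
        omega

/-- The final position of the `n`-th marker. -/
noncomputable def limMarker (n : ℕ) : ℕ :=
  marker (exists_marker_stable n).choose n

theorem eventually_marker_eq (n : ℕ) : ∀ᶠ s in Filter.atTop, marker s n = limMarker n :=
  Filter.eventually_atTop.2 ⟨_, (exists_marker_stable n).choose_spec⟩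

theorem strictMono_limMarker : StrictMono limMarker := fun m n h => by
  obtain ⟨s, hm, hn⟩ := ((eventually_marker_eq m).and (eventually_marker_eq n)).exists
  rw [← hm, ← hn]
  exact strictMono_marker s h

theorem range_limMarker : Set.range limMarker = maxSetᶜ := by
  ext x
  rw [Set.mem_compl_iff, notMem_maxSet]
  constructor
  · rintro ⟨n, rfl⟩ s
    obtain ⟨t, ht, hs⟩ := ((eventually_marker_eq n).and (Filter.eventually_ge_atTop s)).exists
    rw [← ht]
    exact exists_marker_eq hs n
  · intro h
    have hev : ∀ᶠ s in Filter.atTop, ∀ n ∈ Set.Iic x, marker s n = limMarker n :=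
      (Set.finite_Iic x).eventually_all.2 fun n _ => eventually_marker_eq n
    obtain ⟨s, hs⟩ := hev.exists
    obtain ⟨n, hn⟩ := h s
    exact ⟨n, (hs n (hn ▸ (strictMono_marker s).le_apply)).symm.trans hn⟩

/-- Otherwise a late stage coding the pair of markers would still move marker `n`. -/
theorem limState_limMarker_le {n m : ℕ} (h : n ≤ m) :
    limState n (limMarker m) ≤ limState n (limMarker n) := by
  by_contra! hlt
  obtain ⟨d, rfl⟩ := Nat.exists_eq_add_of_le h
  have hev := (((eventually_marker_eq n).and (eventually_marker_eq (n + d))).and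
    ((eventually_estate_eq n (limMarker n)).and
      (eventually_estate_eq n (limMarker (n + d))))).and
    ((Filter.tendsto_add_atTop_nat 1).eventually (eventually_marker_eq n))
  obtain ⟨t, ht⟩ := Filter.eventually_atTop.1 hev
  -- The third coded component only serves to make the stage late.
  obtain ⟨s, hs, h₁, h₂⟩ : ∃ s ≥ t, s.unpair.1 = n ∧ s.unpair.2.unpair.1 = d :=
    ⟨Nat.pair n (Nat.pair d t), (Nat.right_le_pair _ _).trans (Nat.right_le_pair _ _),
      by simp, by simp⟩
  obtain ⟨⟨⟨hn, hd⟩, hen, hed⟩, hn'⟩ := ht s hs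
  have hmove : move s (history s) = (n, d) := by
    simp only [move, h₁, h₂]
    refine congrArg _ (if_pos ?_)
    change estate s n (marker s n) < estate s n (marker s (n + d))
    rwa [hn, hd, hen, hed]
  have : marker (s + 1) n = marker s (n + d) := by simp [marker_succ, hmove, shift]
  rw [hn', hd] at this
  rw [← this] at hlt
  exact lt_irrefl _ hlt

theorem eventually_limState_const (e : ℕ) :
    ∃ t, ∀ n ≥ t, limState e (limMarker n) = limState e (limMarker t) := by
  have hanti : Antitone fun k => limState e (limMarker (e + k)) :=
    antitone_nat_of_succ_le fun k => by
      -- A rise of the `e`-state is also a rise of the finer `(e + k)`-state.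
      by_contra! hlt
      exact absurd (limState_lt_add hlt k) (not_lt.2 (limState_limMarker_le (by omega)))
  obtain ⟨k, hk⟩ := exists_forall_ge_eq_of_antitone hanti
  refine ⟨e + k, fun n hn => ?_⟩
  obtain ⟨j, rfl⟩ := Nat.exists_eq_add_of_le (show e ≤ n by omega)
  exact hk j (by omega)

/-- The complement of `maxSet` is cohesive. -/
theorem finite_inter_or_finite_diff (e : ℕ) :
    (W e ∩ maxSetᶜ).Finite ∨ (maxSetᶜ \ W e).Finite := by
  -- The last digit of the `(e + 1)`-state is membership in `W e`.
  obtain ⟨t, ht⟩ := eventually_limState_const (e + 1)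
  have hmem : ∀ n ≥ t, (limMarker n ∈ W e ↔ limMarker t ∈ W e) := fun n hn => by
    have h := ht n hn
    rw [limState_succ, limState_succ] at h
    by_cases h₁ : limMarker n ∈ W e <;> by_cases h₂ : limMarker t ∈ W e <;>
      simp [h₁, h₂] at h ⊢ <;> omega
  have hfin : (limMarker '' Set.Iio t).Finite := (Set.finite_Iio t).image _
  rw [← range_limMarker]
  by_cases h : limMarker t ∈ W e
  · refine Or.inr (hfin.subset ?_)
    rintro _ ⟨⟨n, rfl⟩, hn⟩
    exact ⟨n, not_le.1 fun hle => hn ((hmem n hle).2 h), rfl⟩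
  · refine Or.inl (hfin.subset ?_)
    rintro _ ⟨hn, n, rfl⟩
    exact ⟨n, not_le.1 fun hle => h ((hmem n hle).1 hn), rfl⟩

theorem infinite_compl_maxSet : maxSetᶜ.Infinite :=
  range_limMarker ▸ Set.infinite_range_of_injective strictMono_limMarker.injective

end MaximalSet

open MaximalSet

/-! ### Splits of a set with cohesive complement -/

theorem isRE_W (e : ℕ) : IsRE (W e) :=
  (Code.eval_part.comp (Computable.const (Denumerable.ofNat Code e)) Computable.id).dom_re

theorem IsRE.union {A B : Set ℕ} (hA : IsRE A) (hB : IsRE B) : IsRE (A ∪ B) := by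
  obtain ⟨k, hk, h⟩ := Partrec.merge' hA hB
  refine hk.dom_re.of_eq fun x => ?_
  rw [(h x).2]
  simp [Part.assert]

/-- A set is semilow₁.₅ if some r.e. set meets exactly the same `W e` infinitely often as its
complement does. -/
theorem IsSemilowOnePointFive.of_isRE {A Z : Set ℕ} (hZ : IsRE Z)
    (h : ∀ e, (W e ∩ Aᶜ).Infinite ↔ (W e ∩ Z).Infinite) : IsSemilowOnePointFive A := by
  -- Currying a code for this function at `e` gives an index of `W e ∩ Z`, injectively in `e`.
  have hpart : Partrec fun p : ℕ =>
      ((Denumerable.ofNat Code p.unpair.1).eval p.unpair.2).bind fun y =>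
        (Part.assert (p.unpair.2 ∈ Z) fun _ => Part.some ()).map fun _ => y := by
    refine Partrec.bind (Code.eval_part.comp
      ((Computable.ofNat Code).comp (Computable.fst.comp Computable.unpair))
      (Computable.snd.comp Computable.unpair)) ?_
    exact Partrec.map ((show Partrec _ from hZ).comp
      (Computable.snd.comp (Computable.unpair.comp Computable.fst)))
      (Computable.snd.comp Computable.fst)
  obtain ⟨c, hc⟩ := Code.exists_code.1 (Partrec.nat_iff.1 hpart)
  refine ⟨fun e => Encodable.encode (c.curry e), ?_, ?_, fun e => ?_⟩
  · exact (Primrec.encode.comp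
      (Code.primrec₂_curry.comp (Primrec.const c) Primrec.id)).to_comp
  · exact fun a b hab => (Code.curry_inj (Encodable.encode_injective hab)).2
  · have : W (Encodable.encode (c.curry e)) = W e ∩ Z := by
      ext x
      simp [W, Code.eval_curry, hc, Part.assert]
    simp only [InfIdx, Set.mem_ofPred_eq, this]
    exact h e

/-- A splitting of a set with cohesive complement has a semilow₁.₅ half. -/
theorem IsSplit.isSemilowOnePointFive_or {B X Y : Set ℕ}
    (hB : ∀ e, (W e ∩ Bᶜ).Finite ∨ (Bᶜ \ W e).Finite) (h : IsSplit B X Y) :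
    IsSemilowOnePointFive X ∨ IsSemilowOnePointFive Y := by
  have hBX : ∀ x, x ∈ B ↔ x ∈ X ∨ x ∈ Y := fun x => by rw [← h.union_eq]; rfl
  have hXY : ∀ x, x ∈ X → x ∉ Y := fun _ hx => Set.disjoint_left.1 h.disj hx
  by_cases hex : ∃ e, (W e ∩ Y).Finite ∧ (W e ∩ Bᶜ).Infinite
  · obtain ⟨e, hfin, hinf⟩ := hex
    have hdiff : (Bᶜ \ W e).Finite := (hB e).resolve_left hinf
    refine Or.inr (.of_isRE (h.re_left.union (isRE_W e)) fun k => not_congr ⟨?_, ?_⟩)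
    · refine fun hk => (hk.union hfin).subset ?_
      rintro x ⟨hx, hx' | hx'⟩
      · exact Or.inl ⟨hx, hXY x hx'⟩
      · by_cases hy : x ∈ Y
        · exact Or.inr ⟨hx', hy⟩
        · exact Or.inl ⟨hx, hy⟩
    · refine fun hk => (hk.union hdiff).subset ?_
      rintro x ⟨hx, hy⟩
      by_cases hz : x ∈ X ∪ W e
      · exact Or.inl ⟨hx, hz⟩
      · rw [Set.mem_union, not_or] at hz
        exact Or.inr ⟨fun hb => ((hBX x).1 hb).elim hz.1 hy, hz.2⟩
  · push Not at hex
    refine Or.inl (.of_isRE h.re_right fun k => not_congr ⟨?_, ?_⟩)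
    · refine fun hk => hk.subset ?_
      exact fun x hx => ⟨hx.1, fun hX => hXY x hX hx.2⟩
    · refine fun hk => (hk.union (hex k hk)).subset ?_
      rintro x ⟨hx, hX⟩
      by_cases hy : x ∈ Y
      · exact Or.inl ⟨hx, hy⟩
      · exact Or.inr ⟨hx, fun hb => ((hBX x).1 hb).elim hX hy⟩

namespace MaximalSet

/-! ### Diagonalization against a reduction -/

/-- The number of `x < s` that are enumerated into `W e` by stage `s`. -/
def stageCount (s e : ℕ) : ℕ :=
  ((List.range s).filter fun x => stage s e x = true).length

theorem primrec_stageCount : Primrec₂ stageCount := by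
  have h : PrimrecRel fun (x : ℕ) (q : ℕ × ℕ) => stage q.1 q.2 x = true :=
    Primrec.eq.comp (primrec_stage.comp (Primrec.snd.pair Primrec.fst)) (Primrec.const true)
  exact Primrec.list_length.comp
    (h.listFilter.comp (Primrec.list_range.comp Primrec.fst) Primrec.id)

theorem stageCount_eq_ncard (s e : ℕ) :
    stageCount s e = {x | x < s ∧ stage s e x = true}.ncard := by
  rw [stageCount, ← List.toFinset_card_of_nodup (List.nodup_range.filter _),
    ← Set.ncard_coe_finset]
  congr 1
  ext x
  simp

theorem stageCount_le {e : ℕ} (h : (W e).Finite) (s : ℕ) : stageCount s e ≤ (W e).ncard := by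
  rw [stageCount_eq_ncard]
  exact Set.ncard_le_ncard (fun x hx => mem_W_iff_stage.2 ⟨s, hx.2⟩) h

theorem tendsto_stageCount {e : ℕ} (h : (W e).Infinite) :
    Filter.Tendsto (fun s => stageCount s e) Filter.atTop Filter.atTop := by
  refine Filter.tendsto_atTop.2 fun b => ?_
  obtain ⟨F, hF, hcard⟩ := h.exists_subset_card_eq b
  have hev : ∀ᶠ s in Filter.atTop, ∀ x ∈ F, x < s ∧ stage s e x = true := by
    refine F.eventually_all.2 fun x hx => ?_
    obtain ⟨t, ht⟩ := mem_W_iff_stage.1 (hF hx)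
    filter_upwards [Filter.eventually_gt_atTop x, Filter.eventually_ge_atTop t] with s h₁ h₂
    exact ⟨h₁, stage_mono h₂ ht⟩
  filter_upwards [hev] with s hs
  rw [stageCount_eq_ncard, ← hcard, ← Set.ncard_coe_finset]
  exact Set.ncard_le_ncard hs ((Set.finite_Iio s).subset fun x hx => hx.1)

theorem eventually_stageCount_lt {a b : ℕ} (ha : (W a).Finite) (hb : (W b).Infinite) :
    ∀ᶠ s in Filter.atTop, stageCount s a < stageCount s b := by
  filter_upwards [(tendsto_stageCount hb).eventually_gt_atTop (W a).ncard] with s hs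
  exact (stageCount_le ha s).trans_lt hs

/-- For computable `f` there is a partition of `ℕ` into `W a` and `W b` that puts `s` into the part
whose image under `f` has the smaller stage count at `s`. -/
theorem exists_balanced_partition {f : ℕ → ℕ} (hf : Computable f) :
    ∃ a b : ℕ, (∀ s, s ∈ W a ↔ stageCount s (f a) ≤ stageCount s (f b)) ∧
      ∀ s, s ∈ W b ↔ s ∉ W a := by
  classical
  let idx : Code → ℕ → ℕ := fun c i => f (Encodable.encode (c.curry i))
  have hidx : ∀ i, Computable fun p : Code × ℕ => stageCount p.2.unpair.2 (idx p.1 i) := fun i =>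
    primrec_stageCount.to_comp.comp
      (Primrec.snd.comp (Primrec.unpair.comp Primrec.snd)).to_comp
      (hf.comp (Primrec.encode.comp
        (Code.primrec₂_curry.comp Primrec.fst (Primrec.const i))).to_comp)
  let side : Code → ℕ → Bool := fun c s =>
    decide (stageCount s (idx c 0) ≤ stageCount s (idx c 1))
  have hside : Computable fun p : Code × ℕ =>
      side p.1 p.2.unpair.2 == decide (p.2.unpair.1 = 0) :=
    Primrec.beq.to_comp.comp
      (Primrec.nat_le.decide.to_comp.comp (hidx 0) (hidx 1))
      (Primrec.eq.decide.comp (Primrec.fst.comp (Primrec.unpair.comp Primrec.snd))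
        (Primrec.const 0)).to_comp
  have hpart : Partrec₂ fun (c : Code) (p : ℕ) =>
      bif side c p.unpair.2 == decide (p.unpair.1 = 0) then Part.some 0 else Part.none :=
    Partrec.cond hside (Computable.const 0).partrec Partrec.none
  -- By the recursion theorem, `c` may consult the indices of its own two sections, 0 and 1.
  obtain ⟨c, hc⟩ := Code.fixed_point₂ hpart
  have hW : ∀ i s, s ∈ W (Encodable.encode (c.curry i)) ↔ side c s = decide (i = 0) := by
    intro i s
    simp only [W, Set.mem_ofPred_eq, Denumerable.ofNat_encode, Code.eval_curry, hc,
      Nat.unpair_pair]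
    cases h : (side c s == decide (i = 0)) <;> simp_all
  refine ⟨Encodable.encode (c.curry 0), Encodable.encode (c.curry 1), fun s => ?_, fun s => ?_⟩
  · rw [hW]
    simp [side, idx]
  · rw [hW, hW]
    simp

end MaximalSet

/-- A set with infinite cohesive complement is not semilow₁.₅. -/
theorem not_isSemilowOnePointFive {B : Set ℕ} (hinf : Bᶜ.Infinite)
    (hB : ∀ e, (W e ∩ Bᶜ).Finite ∨ (Bᶜ \ W e).Finite) : ¬ IsSemilowOnePointFive B := by
  rintro ⟨f, hf, -, h⟩
  obtain ⟨a, b, ha, hb⟩ := exists_balanced_partition hf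
  have hdiff : Bᶜ \ W a = W b ∩ Bᶜ := by
    ext s
    rw [Set.mem_inter_iff, hb]
    exact and_comm
  have hunion : Bᶜ = (W a ∩ Bᶜ) ∪ (Bᶜ \ W a) := by
    rw [Set.inter_comm, Set.inter_union_sdiff]
  have key : ∀ {i : ℕ}, (∀ᶠ s in Filter.atTop, s ∉ W i) → (W i ∩ Bᶜ).Finite := fun {i} hi => by
    obtain ⟨t, ht⟩ := Filter.eventually_atTop.1 hi
    exact (Set.finite_Iio t).subset fun s hs => not_le.1 fun hle => ht s hle hs.1
  have h' : ∀ e, (W e ∩ Bᶜ).Finite ↔ (W (f e)).Finite := fun e => not_iff_not.1 (h e)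
  rcases hB a with hfin | hfin
  · have hbinf : (W b ∩ Bᶜ).Infinite := fun hbf => hinf (hunion ▸ hfin.union (hdiff ▸ hbf))
    refine hbinf (key ?_)
    filter_upwards [eventually_stageCount_lt ((h' a).1 hfin) ((h b).1 hbinf)] with s hs
    rw [hb, not_not, ha]
    exact hs.le
  · have hainf : (W a ∩ Bᶜ).Infinite := fun haf => hinf (hunion ▸ haf.union hfin)
    refine hainf (key ?_)
    filter_upwards [eventually_stageCount_lt ((h' b).1 (hdiff ▸ hfin)) ((h a).1 hainf)] with s hs
    rw [ha]
    exact not_le.2 hs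

theorem corollary6p3 :
    ∃ B : Set ℕ, IsRE B ∧ ¬ IsSemilowOnePointFive B ∧
      ∀ X Y : Set ℕ, IsSplit B X Y → IsSemilowOnePointFive X ∨ IsSemilowOnePointFive Y :=
  ⟨maxSet, isRE_maxSet, not_isSemilowOnePointFive infinite_compl_maxSet finite_inter_or_finite_diff,
    fun _ _ h => h.isSemilowOnePointFive_or finite_inter_or_finite_diff⟩
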